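/- Let $\mathcal S\subset\mathbb R^3$ be the unit sphere with spherical coordinates $(\vartheta,\varphi)\in[0,\pi]\times[0,2\pi)$ and surface measure $d\sigma=\sin\vartheta\,d\vartheta\,d\varphi$, and write $\langle f,g\rangle=\int_{\mathcal S}\overline f\,g\,d\sigma$. A function $F(x,\mathbf m)$ of a point $x\in\mathcal S$ and a complex tangent vector $\mathbf m=a+ib$ at $x$ (with $a,b$ an orthonormal basis of the tangent plane, $a\times b=x$) has spin weight $s\in\mathbb Z$ if $F(x,e^{i\psi}\mathbf m)=e^{is\psi}F(x,\mathbf m)$ for all real $\psi$; it is identified with the scalar function of $(\vartheta,\varphi)$ obtained for $\mathbf m=e_\vartheta+ie_\varphi$. Let $\mathcal L^2_s$ be the Hilbert space of (classes of) square integrable functions of spin weight $s$. Let $Y_l^m$ be the spherical harmonics, $$Y_l^m(\vartheta,\varphi)=(-1)^m\sqrt{\tfrac{2l+1}{4\pi}\tfrac{(l-m)!}{(l+m)!}}\,P_l^m(\cos\vartheta)\,e^{im\varphi}\quad(0\le m\le l),\qquad Y_l^m=\overline{Y_l^{-m}}\quad(-l\le m<0),$$ with $P_l^m(t)=(1-t^2)^{m/2}\frac{d^m}{dt^m}P_l(t)$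 and $P_l$ the Legendre polynomials. On functions $f$ of spin weight $s$ put $$\eth f=-\Big(\partial_\vartheta+\tfrac{i}{\sin\vartheta}\partial_\varphi-s\cot\vartheta\Big)f,\qquad \bar\eth f=-\Big(\partial_\vartheta-\tfrac{i}{\sin\vartheta}\partial_\varphi+s\cot\vartheta\Big)f,$$ which have spin weight $s+1$ and $s-1$, respectively. For $|s|\le l$ and $|m|\le l$ let $${}_sY_l^m=\sqrt{\tfrac{(l-s)!}{(l+s)!}}\;\eth^sY_l^m\quad(s\ge0),\qquad {}_sY_l^m=\sqrt{\tfrac{(l+s)!}{(l-s)!}}\,(-1)^s\,\bar\eth^{-s}Y_l^m\quad(s\le0)$$ for $0<\vartheta<\pi$, extended by continuity to $\vartheta\in\{0,\pi\}$. Let ${}_s\mathcal H_l=\operatorname{span}\{{}_sY_l^m:|m|\le l\}$ and $${}_s\mathcal K_l(x,y)=\sum_{m=-l}^l{}_sY_l^m(x)\,\overline{{}_sY_l^m(y)},\qquad ({}_s\mathcal K_l*f)(x)=\int_{\mathcal S}{}_s\mathcal K_l(x,y)\,f(y)\,d\sigma(y).$$ **Proposition.** Let $s\in\mathbb Z$ and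 $l\in\mathbb N_0$ with $|s|\le l$. Then ${}_s\mathcal H_l\subset\mathcal L^2_s$, and ${}_s\mathcal K_l$ is the reproducing kernel of ${}_s\mathcal H_l$: for every $y$, ${}_s\mathcal K_l(\cdot,y)\in{}_s\mathcal H_l$, and for every $f\in{}_s\mathcal H_l$ and every $x$ the integral defining $({}_s\mathcal K_l*f)(x)$ converges absolutely and $$({}_s\mathcal K_l*f)(x)=f(x).$$ Moreover, for every $f\in\mathcal L^2_s$ the integral defining $({}_s\mathcal K_l*f)(x)$ converges absolutely for every $x$, $$({}_s\mathcal K_l*f)(x)={}_sf_l(x):=\sum_{m=-l}^l\langle{}_sY_l^m,f\rangle\,{}_sY_l^m(x),$$ and the operator $f\mapsto{}_s\mathcal K_l*f$ is the orthogonal projection of $\mathcal L^2_s$ onto ${}_s\mathcal H_l$. -/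

import Mathlib

open MeasureTheory

noncomputable section

namespace SpinWeighted

/-! ### The sphere in spherical coordinates

A point of the sphere is given by `p = (ϑ, φ)`, with `p.1 = ϑ ∈ [0, π]` and `p.2 = φ ∈ [0, 2π)`.
Functions are written as functions on `ℝ × ℝ`; only their values on `coordDomain` matter. -/

/-- The range `[0, π] × [0, 2π)` of the spherical coordinates `(ϑ, φ)`. -/
def coordDomain : Set (ℝ × ℝ) := Set.Icc 0 Real.pi ×ˢ Set.Ico 0 (2 * Real.pi)

/-- The surface measure `dσ = sin ϑ dϑ dφ` of the unit sphere. -/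
def sigma : Measure (ℝ × ℝ) :=
  ((volume : Measure (ℝ × ℝ)).restrict coordDomain).withDensity
    (fun p => ENNReal.ofReal (Real.sin p.1))

/-- The point of the unit sphere with coordinates `(ϑ, φ)`. -/
def spherePoint (p : ℝ × ℝ) : Fin 3 → ℝ :=
  ![Real.sin p.1 * Real.cos p.2, Real.sin p.1 * Real.sin p.2, Real.cos p.1]

/-- The unit vector `e_ϑ`. -/
def eTheta (p : ℝ × ℝ) : Fin 3 → ℝ :=
  ![Real.cos p.1 * Real.cos p.2, Real.cos p.1 * Real.sin p.2, -Real.sin p.1]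

/-- The unit vector `e_φ`. -/
def ePhi (p : ℝ × ℝ) : Fin 3 → ℝ :=
  ![-Real.sin p.2, Real.cos p.2, 0]

/-! ### Spin weight -/

/-- `m = a + i b` is a complex tangent vector at the point `x` of the unit sphere, where `(a, b)`
is an orthonormal basis of the tangent plane at `x` with `a × b = x`. -/
def IsTangentFrame (x : Fin 3 → ℝ) (m : Fin 3 → ℂ) : Prop :=
  ∃ a b : Fin 3 → ℝ, a ⬝ᵥ a = 1 ∧ b ⬝ᵥ b = 1 ∧ a ⬝ᵥ b = 0 ∧ crossProduct a b = x ∧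
    m = fun j => (a j : ℂ) + Complex.I * (b j : ℂ)

/-- The complex tangent vector `e_ϑ + i e_φ` singled out by the coordinates. -/
def coordFrame (p : ℝ × ℝ) : Fin 3 → ℂ :=
  fun j => (eTheta p j : ℂ) + Complex.I * (ePhi p j : ℂ)

/-- A function `F x m` of a point and a complex tangent vector there has spin weight `s` if it is
multiplied by `exp (i s ψ)` whenever `m` is replaced by `exp (i ψ) m`. -/
def HasSpinWeight (s : ℤ) (F : (Fin 3 → ℝ) → (Fin 3 → ℂ) → ℂ) : Prop :=
  ∀ (x : Fin 3 → ℝ) (m : Fin 3 → ℂ) (ψ : ℝ), IsTangentFrame x m →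
    F x (fun j => Complex.exp (Complex.I * ψ) * m j)
      = Complex.exp (Complex.I * s * ψ) * F x m

/-- The scalar function of `(ϑ, φ)` by which a spin weighted function is given. -/
def coordRep (F : (Fin 3 → ℝ) → (Fin 3 → ℂ) → ℂ) : ℝ × ℝ → ℂ :=
  fun p => F (spherePoint p) (coordFrame p)

/-- The space `L²_s` of (classes of) square integrable functions on the sphere of spin weight `s`,
with the inner product `⟪f, g⟫ = ∫ conj f * g dσ`. -/
def spinL2 (s : ℤ) : Submodule ℂ (Lp ℂ 2 sigma) where
  carrier := {f | ∃ F, HasSpinWeight s F ∧ (f : ℝ × ℝ → ℂ) =ᵐ[sigma] coordRep F}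
  zero_mem' := by
    refine ⟨fun _ _ => 0, fun _ _ _ _ => by simp, ?_⟩
    exact Lp.coeFn_zero _ _ _
  add_mem' := by
    rintro f g ⟨F, hF, hf⟩ ⟨G, hG, hg⟩
    refine ⟨fun x m => F x m + G x m, fun x m ψ h => ?_, ?_⟩
    · simp only [hF x m ψ h, hG x m ψ h]; ring
    · filter_upwards [Lp.coeFn_add f g, hf, hg] with p h1 h2 h3
      rw [h1, Pi.add_apply, h2, h3]; rfl
  smul_mem' := by
    rintro c f ⟨F, hF, hf⟩
    refine ⟨fun x m => c * F x m, fun x m ψ h => ?_, ?_⟩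
    · simp only [hF x m ψ h]; ring
    · filter_upwards [Lp.coeFn_smul c f, hf] with p h1 h2
      rw [h1, Pi.smul_apply, h2]; rfl

/-! ### Spherical harmonics -/

/-- The Legendre polynomial `P_l`, by Rodrigues' formula. -/
def legendrePoly (l : ℕ) : Polynomial ℝ :=
  Polynomial.C (1 / (2 ^ l * (l.factorial : ℝ))) *
    (Polynomial.derivative^[l] ((Polynomial.X ^ 2 - 1) ^ l))

/-- The associated Legendre function `P_l^m (t) = (1 - t ^ 2) ^ (m / 2) * (d / dt) ^ m P_l (t)`. -/
def assocLegendre (l m : ℕ) (t : ℝ) : ℝ :=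
  Real.sqrt (1 - t ^ 2) ^ m * (Polynomial.derivative^[m] (legendrePoly l)).eval t

/-- The spherical harmonic `Y_l^m` for `m ≥ 0`. -/
def sphHarmonicNat (l m : ℕ) (p : ℝ × ℝ) : ℂ :=
  (-1) ^ m *
    (Real.sqrt ((2 * l + 1) / (4 * Real.pi) * ((l - m).factorial / (l + m).factorial)) : ℂ) *
    (assocLegendre l m (Real.cos p.1) : ℂ) * Complex.exp (Complex.I * m * p.2)

/-- The spherical harmonic `Y_l^m`, `-l ≤ m ≤ l`; `Y_l^m = conj Y_l^(-m)` for `m < 0`. -/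
def sphHarmonic (l : ℕ) (m : ℤ) (p : ℝ × ℝ) : ℂ :=
  if 0 ≤ m then sphHarmonicNat l m.toNat p
  else (starRingEnd ℂ) (sphHarmonicNat l (-m).toNat p)

/-- `∂ f / ∂ϑ`. -/
def dTheta (f : ℝ × ℝ → ℂ) (p : ℝ × ℝ) : ℂ := deriv (fun t : ℝ => f (t, p.2)) p.1

/-- `∂ f / ∂φ`. -/
def dPhi (f : ℝ × ℝ → ℂ) (p : ℝ × ℝ) : ℂ := deriv (fun t : ℝ => f (p.1, t)) p.2

/-- The spin raising operator, acting on functions of spin weight `s`. -/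
def eth (s : ℤ) (f : ℝ × ℝ → ℂ) (p : ℝ × ℝ) : ℂ :=
  -(dTheta f p + Complex.I / (Real.sin p.1 : ℂ) * dPhi f p - s * (Real.cot p.1 : ℂ) * f p)

/-- The spin lowering operator, acting on functions of spin weight `s`. -/
def ethBar (s : ℤ) (f : ℝ × ℝ → ℂ) (p : ℝ × ℝ) : ℂ :=
  -(dTheta f p - Complex.I / (Real.sin p.1 : ℂ) * dPhi f p + s * (Real.cot p.1 : ℂ) * f p)

/-- The `k`-th power of `eth`, acting on functions of spin weight `0`. -/
def ethPow : ℕ → (ℝ × ℝ → ℂ) → ℝ × ℝ → ℂ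
  | 0, f => f
  | k + 1, f => eth (k : ℤ) (ethPow k f)

/-- The `k`-th power of `ethBar`, acting on functions of spin weight `0`. -/
def ethBarPow : ℕ → (ℝ × ℝ → ℂ) → ℝ × ℝ → ℂ
  | 0, f => f
  | k + 1, f => ethBar (-(k : ℤ)) (ethBarPow k f)

/-- The differential expression that defines the spin weighted spherical harmonics; it is
meaningful away from the poles, i.e. for `0 < ϑ < π`. -/
def spinHarmonicInterior (s : ℤ) (l : ℕ) (m : ℤ) (p : ℝ × ℝ) : ℂ :=
  if 0 ≤ s then
    (Real.sqrt ((((l : ℤ) - s).toNat.factorial : ℝ) / (((l : ℤ) + s).toNat.factorial : ℝ)) : ℂ) *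
      ethPow s.toNat (sphHarmonic l m) p
  else
    (Real.sqrt ((((l : ℤ) + s).toNat.factorial : ℝ) / (((l : ℤ) - s).toNat.factorial : ℝ)) : ℂ) *
      (-1 : ℂ) ^ s * ethBarPow (-s).toNat (sphHarmonic l m) p

/-- The spin weighted spherical harmonic `_sY_l^m` (for `|s| ≤ l` and `|m| ≤ l`), with its values
at `ϑ = 0` and `ϑ = π` (where `eth` has a singular coefficient) obtained by continuity. -/
def spinHarmonic (s : ℤ) (l : ℕ) (m : ℤ) : ℝ × ℝ → ℂ :=
  extendFrom (Set.Ioo 0 Real.pi ×ˢ Set.univ) (spinHarmonicInterior s l m)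

/-! ### The spaces `_sH_l`, the kernel and the convolution -/

/-- The space `_sH_l` spanned by the functions `_sY_l^m`, `|m| ≤ l`. -/
def harmonicSpace (s : ℤ) (l : ℕ) : Submodule ℂ (ℝ × ℝ → ℂ) :=
  Submodule.span ℂ (spinHarmonic s l '' Set.Icc (-(l : ℤ)) l)

/-- `_sH_l` as a subspace of `L²_s`. -/
def harmonicL2 (s : ℤ) (l : ℕ) : Submodule ℂ (spinL2 s) where
  carrier := {f | ∃ g ∈ harmonicSpace s l, ((f : Lp ℂ 2 sigma) : ℝ × ℝ → ℂ) =ᵐ[sigma] g}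
  zero_mem' := ⟨0, zero_mem _, Lp.coeFn_zero _ _ _⟩
  add_mem' := by
    rintro f f' ⟨g, hg, h⟩ ⟨g', hg', h'⟩
    exact ⟨g + g', add_mem hg hg', (Lp.coeFn_add _ _).trans (h.add h')⟩
  smul_mem' := by
    rintro c f ⟨g, hg, h⟩
    exact ⟨c • g, Submodule.smul_mem _ c hg, (Lp.coeFn_smul c _).trans (h.const_smul c)⟩

instance harmonicSpace_finite (s : ℤ) (l : ℕ) : FiniteDimensional ℂ (harmonicSpace s l) :=
  FiniteDimensional.span_of_finite ℂ ((Set.finite_Icc _ _).image _)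

/-- `_sH_l` is finite-dimensional, so that the orthogonal projection onto it exists. -/
instance harmonicL2_finite (s : ℤ) (l : ℕ) : FiniteDimensional ℂ (harmonicL2 s l) := by
  let W : Submodule ℂ (harmonicSpace s l × spinL2 s) :=
    { carrier := {q | ((q.2 : Lp ℂ 2 sigma) : ℝ × ℝ → ℂ) =ᵐ[sigma] (q.1 : ℝ × ℝ → ℂ)}
      zero_mem' := Lp.coeFn_zero _ _ _
      add_mem' := fun {a b} ha hb => (Lp.coeFn_add _ _).trans (Filter.EventuallyEq.add ha hb)
      smul_mem' := by
        intro c a ha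
        have ha' : ((a.2 : Lp ℂ 2 sigma) : ℝ × ℝ → ℂ) =ᵐ[sigma] (a.1 : ℝ × ℝ → ℂ) := ha
        exact (Lp.coeFn_smul c _).trans (ha'.const_smul c) }
  have hinj : Function.Injective ((LinearMap.fst ℂ _ _).comp W.subtype) := by
    rw [injective_iff_map_eq_zero]
    rintro ⟨⟨g, f⟩, h⟩ h0
    have h0' : g = 0 := h0
    subst h0'
    have : f = 0 := by
      apply Subtype.ext
      exact Lp.ext (Filter.EventuallyEq.trans h (Lp.coeFn_zero _ _ _).symm)
    subst this
    rfl
  have : FiniteDimensional ℂ W := FiniteDimensional.of_injective _ hinj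
  have hW : harmonicL2 s l = W.map (LinearMap.snd ℂ _ _) := by
    ext f
    constructor
    · rintro ⟨g, hg, h⟩
      exact ⟨(⟨g, hg⟩, f), h, rfl⟩
    · rintro ⟨⟨g, f'⟩, h, rfl⟩
      exact ⟨g, g.2, h⟩
  rw [hW]
  infer_instance

/-- The kernel `_sK_l (x, y) = ∑ m, _sY_l^m (x) * conj (_sY_l^m (y))`. -/
def kernel (s : ℤ) (l : ℕ) (x y : ℝ × ℝ) : ℂ :=
  ∑ m ∈ Finset.Icc (-(l : ℤ)) l,
    spinHarmonic s l m x * (starRingEnd ℂ) (spinHarmonic s l m y)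

/-- The convolution `(_sK_l * f) (x) = ∫ _sK_l (x, y) f (y) dσ (y)`. -/
def kernelConv (s : ℤ) (l : ℕ) (f : ℝ × ℝ → ℂ) (x : ℝ × ℝ) : ℂ :=
  ∫ y, kernel s l x y * f y ∂sigma

/-- The Fourier coefficient `⟨_sY_l^m, f⟩`. -/
def fourierCoeff (s : ℤ) (l : ℕ) (m : ℤ) (f : ℝ × ℝ → ℂ) : ℂ :=
  ∫ y, (starRingEnd ℂ) (spinHarmonic s l m y) * f y ∂sigma

/-- The degree `l` part `_sf_l = ∑ m, ⟨_sY_l^m, f⟩ _sY_l^m` of the Fourier series of `f`. -/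
def fourierPart (s : ℤ) (l : ℕ) (f : ℝ × ℝ → ℂ) (x : ℝ × ℝ) : ℂ :=
  ∑ m ∈ Finset.Icc (-(l : ℤ)) l, fourierCoeff s l m f * spinHarmonic s l m x

end SpinWeighted

end

noncomputable section

namespace SpinWeighted

section PolynomialIdentities

open Polynomial

/-! ### Derivatives of the polynomials `(X - 1) ^ a * (X + 1) ^ b` -/

/-- The polynomial `(X - 1) ^ a * (X + 1) ^ b`. -/
def jacobiPow (a b : ℕ) : ℝ[X] := (X - 1) ^ a * (X + 1) ^ b

theorem X_pow_mul_iterate_derivative (m b : ℕ) (p : ℝ[X]) :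
    X ^ m * derivative^[b + m] (X ^ b * p) = derivative^[b] (X ^ (b + m) * derivative^[m] p) := by
  induction p using Polynomial.induction_on' with
  | add p q hp hq => simp only [mul_add, iterate_map_add, hp, hq]
  | monomial k c =>
    rw [← C_mul_X_pow_eq_monomial, mul_left_comm, iterate_derivative_C_mul, iterate_derivative_C_mul,
      ← pow_add, iterate_derivative_X_pow_eq_C_mul, iterate_derivative_X_pow_eq_C_mul]
    rw [show X ^ (b + m) * (C c * (C ((k.descFactorial m : ℕ) : ℝ) * X ^ (k - m))) =
      C (c * k.descFactorial m) * X ^ (b + m + (k - m)) by rw [C_mul, pow_add]; ring,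
      iterate_derivative_C_mul, iterate_derivative_X_pow_eq_C_mul]
    rcases lt_or_ge k m with h | h
    · rw [Nat.descFactorial_of_lt h, Nat.descFactorial_of_lt (by omega : b + k < b + m)]
      simp
    · obtain ⟨j, rfl⟩ := Nat.exists_eq_add_of_le h
      have h1 : b + (m + j) - (b + m) = j := by omega
      have h2 : b + m + (m + j - m) - b = m + j := by omega
      have h3 : b + m + (m + j - m) = b + m + j := by omega
      have key : (b + (m + j)).descFactorial (b + m)
          = (m + j).descFactorial m * (b + m + j).descFactorial b := by
        have e1 := Nat.factorial_mul_descFactorial (show b + m ≤ b + (m + j) by omega)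
        have e2 := Nat.factorial_mul_descFactorial (show m ≤ m + j by omega)
        have e3 := Nat.factorial_mul_descFactorial (show b ≤ b + m + j by omega)
        have h4 : b + m + j - b = m + j := by omega
        have h5 : m + j - m = j := by omega
        rw [h1] at e1
        rw [h5] at e2
        rw [h4, ← e2] at e3
        rw [← add_assoc] at e1 ⊢
        apply Nat.eq_of_mul_eq_mul_left (Nat.factorial_pos j)
        rw [e1, ← e3]; ring
      rw [h1, h2, h3, key]
      push_cast
      simp only [C_mul, pow_add]
      ring

theorem iterate_derivative_comp_X_add_C (p : ℝ[X]) (c : ℝ) (n : ℕ) :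
    derivative^[n] (p.comp (X + C c)) = (derivative^[n] p).comp (X + C c) := by
  induction n generalizing p with
  | zero => rfl
  | succ n ih =>
    rw [Function.iterate_succ_apply, Function.iterate_succ_apply, derivative_comp, ← ih]
    simp

theorem X_add_C_pow_mul_iterate_derivative (c : ℝ) (m b : ℕ) (p : ℝ[X]) :
    (X + C c) ^ m * derivative^[b + m] ((X + C c) ^ b * p)
      = derivative^[b] ((X + C c) ^ (b + m) * derivative^[m] p) := by
  have h := congrArg (fun r => r.comp (X + C c))
    (X_pow_mul_iterate_derivative m b (p.comp (X + C (-c))))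
  simp only [mul_comp, pow_comp, X_comp, ← iterate_derivative_comp_X_add_C] at h
  have e : (p.comp (X + C (-c))).comp (X + C c) = p := by
    rw [comp_assoc]; simp
  rwa [e] at h

theorem X_add_one_pow_mul_iterate_derivative_jacobiPow (m b c : ℕ) :
    (c.factorial : ℝ[X]) * ((X + 1) ^ m * derivative^[b + m] (jacobiPow (c + m) b))
      = ((c + m).factorial : ℝ[X]) * derivative^[b] (jacobiPow c (b + m)) := by
  have h := X_add_C_pow_mul_iterate_derivative 1 m b ((X - C 1) ^ (c + m))
  rw [iterate_derivative_X_sub_pow] at h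
  have hc : ((c + m).factorial : ℝ[X]) = (c.factorial : ℝ[X]) * ((c + m).descFactorial m : ℝ[X]) := by
    have := Nat.factorial_mul_descFactorial (show m ≤ c + m by omega)
    rw [Nat.add_sub_cancel] at this
    exact_mod_cast this.symm
  simp only [map_one, Nat.add_sub_cancel, nsmul_eq_mul] at h
  rw [jacobiPow, mul_comm ((X - 1) ^ _), h, hc, mul_assoc, ← iterate_derivative_natCast_mul,
    jacobiPow, ← iterate_derivative_natCast_mul, ← iterate_derivative_natCast_mul]
  congr 1
  ring

theorem X_sub_one_pow_mul_iterate_derivative_jacobiPow (m b c : ℕ) :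
    (c.factorial : ℝ[X]) * ((X - 1) ^ m * derivative^[b + m] (jacobiPow b (c + m)))
      = ((c + m).factorial : ℝ[X]) * derivative^[b] (jacobiPow (b + m) c) := by
  have h := X_add_C_pow_mul_iterate_derivative (-1) m b ((X + C 1) ^ (c + m))
  rw [iterate_derivative_X_add_pow] at h
  have hc : ((c + m).factorial : ℝ[X]) = (c.factorial : ℝ[X]) * ((c + m).descFactorial m : ℝ[X]) := by
    have := Nat.factorial_mul_descFactorial (show m ≤ c + m by omega)
    rw [Nat.add_sub_cancel] at this
    exact_mod_cast this.symm
  simp only [map_neg, map_one, Nat.add_sub_cancel, nsmul_eq_mul, ← sub_eq_add_neg] at h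
  rw [jacobiPow, h, hc, mul_assoc, ← iterate_derivative_natCast_mul,
    jacobiPow, ← iterate_derivative_natCast_mul, ← iterate_derivative_natCast_mul]
  congr 1
  ring

theorem coeff_X_add_C_pow_mul_reverse (x y : ℝ) (hx : x ≠ 0) (hy : y ≠ 0) (a b n : ℕ)
    (hn : n ≤ a + b) :
    (x * y) ^ n * ((X + C x) ^ a * (X + C y) ^ b).coeff n
      = x ^ a * y ^ b * ((X + C x) ^ b * (X + C y) ^ a).coeff (a + b - n) := by
  have hrev : ∀ z : ℝ, z ≠ 0 → ∀ k : ℕ, ((X + C z) ^ k).reverse = (1 + C z * X) ^ k := by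
    intro z hz k
    induction k with
    | zero => simpa using reverse_C (1 : ℝ)
    | succ k ih =>
      rw [pow_succ, reverse_mul_of_domain, ih, pow_succ]
      congr 1
      rw [reverse, natDegree_X_add_C, reflect_add, reflect_one_X, reflect_C]
      simp
  have hdeg : ((X + C x) ^ b * (X + C y) ^ a).natDegree = a + b := by
    rw [natDegree_mul (pow_ne_zero _ (X_add_C_ne_zero _)) (pow_ne_zero _ (X_add_C_ne_zero _)),
      natDegree_pow, natDegree_pow, natDegree_X_add_C, natDegree_X_add_C]
    ring
  have h1 : ((X + C x) ^ b * (X + C y) ^ a).coeff (a + b - n)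
      = ((1 + C x * X) ^ b * (1 + C y * X) ^ a).coeff n := by
    rw [← hrev x hx, ← hrev y hy, ← reverse_mul_of_domain, coeff_reverse, hdeg, revAt_le hn]
  rw [h1, mul_comm, ← comp_C_mul_X_coeff, ← coeff_C_mul]
  congr 1
  simp only [mul_comp, pow_comp, add_comp, X_comp, C_comp, C_mul, C_pow]
  rw [show (C x * C y * X + C x : ℝ[X]) = C x * (1 + C y * X) by ring,
    show (C x * C y * X + C y : ℝ[X]) = C y * (1 + C x * X) by ring, mul_pow, mul_pow]
  ring

theorem eval_iterate_derivative_jacobiPow (t : ℝ) (a b n : ℕ) :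
    (derivative^[n] (jacobiPow a b)).eval t
      = n.factorial * ((X + C (t - 1)) ^ a * (X + C (t + 1)) ^ b).coeff n := by
  have h : derivative^[n] (jacobiPow a b) = n.factorial • hasseDeriv n (jacobiPow a b) := by
    rw [← factorial_smul_hasseDeriv]; rfl
  rw [h, eval_smul, nsmul_eq_mul, ← taylor_coeff]
  simp only [jacobiPow, taylor_apply, mul_comp, pow_comp, add_comp, sub_comp, X_comp, one_comp,
    C_add, C_sub, C_1]
  rw [show (X + C t - 1 : ℝ[X]) = X + (C t - 1) by ring,
    show (X + C t + 1 : ℝ[X]) = X + (C t + 1) by ring]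

theorem iterate_derivative_jacobiPow_reflect (t : ℝ) (h1 : t ≠ 1) (h2 : t ≠ -1) (a b n : ℕ)
    (hn : n ≤ a + b) :
    ((a + b - n).factorial : ℝ) * ((t - 1) * (t + 1)) ^ n * (derivative^[n] (jacobiPow a b)).eval t
      = n.factorial * ((t - 1) ^ a * (t + 1) ^ b) *
        (derivative^[a + b - n] (jacobiPow b a)).eval t := by
  rw [eval_iterate_derivative_jacobiPow, eval_iterate_derivative_jacobiPow]
  have := coeff_X_add_C_pow_mul_reverse (t - 1) (t + 1) (sub_ne_zero.2 h1)
    (fun h => h2 (eq_neg_of_add_eq_zero_left h)) a b n hn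
  linear_combination ((a + b - n).factorial : ℝ) * n.factorial * this

/-! ### Integrals over `[-1, 1]` -/

theorem integral_derivative_mul_eq_neg (p q : ℝ[X]) (h1 : p.eval 1 * q.eval 1 = 0)
    (h2 : p.eval (-1) * q.eval (-1) = 0) :
    ∫ t in (-1 : ℝ)..1, (derivative p).eval t * q.eval t
      = -∫ t in (-1 : ℝ)..1, p.eval t * (derivative q).eval t := by
  have h := intervalIntegral.integral_mul_deriv_eq_deriv_mul (a := -1) (b := 1)
    (u := fun t => p.eval t) (v := fun t => q.eval t)
    (fun t _ => p.hasDerivAt t) (fun t _ => q.hasDerivAt t)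
    ((derivative p).continuous.intervalIntegrable _ _)
    ((derivative q).continuous.intervalIntegrable _ _)
  rw [h, h1, h2]
  ring

theorem eval_one_iterate_derivative_jacobiPow {a b n : ℕ} (h : n < a) :
    (derivative^[n] (jacobiPow a b)).eval 1 = 0 := by
  have := pow_sub_dvd_iterate_derivative_of_pow_dvd n
    (Dvd.intro _ rfl : (X - 1 : ℝ[X]) ^ a ∣ jacobiPow a b)
  obtain ⟨r, hr⟩ := this
  rw [hr]
  simp [Nat.sub_ne_zero_of_lt h]

theorem eval_neg_one_iterate_derivative_jacobiPow {a b n : ℕ} (h : n < b) :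
    (derivative^[n] (jacobiPow a b)).eval (-1) = 0 := by
  have := pow_sub_dvd_iterate_derivative_of_pow_dvd n
    (Dvd.intro_left _ rfl : (X + 1 : ℝ[X]) ^ b ∣ jacobiPow a b)
  obtain ⟨r, hr⟩ := this
  rw [hr]
  simp [Nat.sub_ne_zero_of_lt h]

theorem eval_iterate_derivative_jacobiPow_self (t : ℝ) (a b : ℕ) :
    (derivative^[a + b] (jacobiPow a b)).eval t = (a + b).factorial := by
  have hm : ((X + C (t - 1)) ^ a * (X + C (t + 1)) ^ b).Monic :=
    ((monic_X_add_C _).pow a).mul ((monic_X_add_C _).pow b)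
  have hdeg : ((X + C (t - 1)) ^ a * (X + C (t + 1)) ^ b).natDegree = a + b := by
    rw [natDegree_mul (pow_ne_zero _ (X_add_C_ne_zero _)) (pow_ne_zero _ (X_add_C_ne_zero _)),
      natDegree_pow, natDegree_pow, natDegree_X_add_C, natDegree_X_add_C]
    ring
  have h := hm.coeff_natDegree
  rw [hdeg] at h
  rw [eval_iterate_derivative_jacobiPow, h, mul_one]

theorem integral_jacobiPow (a b : ℕ) :
    ∫ t in (-1 : ℝ)..1, (jacobiPow b a).eval t
      = (-1) ^ b * 2 ^ (a + b + 1) * a.factorial * b.factorial / (a + b + 1).factorial := by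
  induction b generalizing a with
  | zero =>
    have h := intervalIntegral.integral_comp_add_right (a := -1) (b := 1) (fun t : ℝ => t ^ a) 1
    have ha : (a : ℝ) + 1 ≠ 0 := by positivity
    have hf : (a.factorial : ℝ) ≠ 0 := by positivity
    simp only [jacobiPow, pow_zero, one_mul, eval_pow, eval_add, eval_X, eval_one, add_zero,
      Nat.factorial_succ]
    rw [h, integral_pow]
    push_cast
    norm_num
    field_simp
  | succ b ih =>
    have h := integral_derivative_mul_eq_neg ((X + 1) ^ (a + 1)) ((X - 1) ^ (b + 1))
      (by simp) (by simp)
    have ha : (a : ℝ) + 1 ≠ 0 := by positivity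
    have e1 : ∀ t : ℝ, (derivative ((X + 1) ^ (a + 1) : ℝ[X])).eval t
        * eval t ((X - 1) ^ (b + 1)) = (a + 1) * (jacobiPow (b + 1) a).eval t := by
      intro t
      simp [jacobiPow, derivative_pow]
      ring
    have e2 : ∀ t : ℝ, ((X + 1) ^ (a + 1) : ℝ[X]).eval t
        * eval t (derivative ((X - 1) ^ (b + 1))) = (b + 1) * (jacobiPow b (a + 1)).eval t := by
      intro t
      simp [jacobiPow, derivative_pow]
      ring
    simp only [e1, e2, intervalIntegral.integral_const_mul, ih] at h
    rw [show a + 1 + b + 1 = a + (b + 1) + 1 by ring] at h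
    apply mul_left_cancel₀ ha
    rw [h, Nat.factorial_succ a, Nat.factorial_succ b]
    push_cast
    ring

theorem integral_iterate_derivative_jacobiPow_mul (a b k : ℕ) (hk : k ≤ a + b) :
    ∫ t in (-1 : ℝ)..1, (derivative^[a + b - k] (jacobiPow a b)).eval t *
        (derivative^[k] (jacobiPow b a)).eval t
      = (-1) ^ (k + b) * (2 ^ (a + b + 1) * a.factorial * b.factorial / (a + b + 1)) := by
  induction k with
  | zero =>
    have hf : ((a + b).factorial : ℝ) ≠ 0 := by positivity
    have ha : (a : ℝ) + b + 1 ≠ 0 := by positivity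
    simp only [Nat.sub_zero, eval_iterate_derivative_jacobiPow_self, Function.iterate_zero, id,
      intervalIntegral.integral_const_mul, integral_jacobiPow, Nat.factorial_succ (a + b)]
    push_cast
    field_simp
    simp
  | succ k ih =>
    have h := integral_derivative_mul_eq_neg (derivative^[a + b - (k + 1)] (jacobiPow a b))
      (derivative^[k] (jacobiPow b a)) ?_ ?_
    · rw [← Function.iterate_succ_apply' derivative, ← Function.iterate_succ_apply' derivative,
        show (a + b - (k + 1)).succ = a + b - k by omega, ih (by omega)] at h
      rw [neg_eq_iff_eq_neg.mp h.symm]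
      ring
    · rcases lt_or_ge k b with h | h
      · rw [eval_one_iterate_derivative_jacobiPow h, mul_zero]
      · rw [eval_one_iterate_derivative_jacobiPow (by omega), zero_mul]
    · rcases lt_or_ge k a with h | h
      · rw [eval_neg_one_iterate_derivative_jacobiPow h, mul_zero]
      · rw [eval_neg_one_iterate_derivative_jacobiPow (by omega), zero_mul]

/-! ### The ladder functions -/

/-- `tan (ϑ / 2)`, written as `(1 - cos ϑ) / sin ϑ`. -/
def halfTan (t : ℝ) : ℝ := (1 - Real.cos t) / Real.sin t

/-- The `ϑ`-dependence, up to a constant factor, of the `k`-th power of `eth` applied to the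
spherical harmonic of degree `l` and order `m`. -/
def ladder (k l : ℕ) (m : ℤ) (t : ℝ) : ℝ :=
  Real.sin t ^ k * halfTan t ^ m *
    (derivative^[l + k] (jacobiPow ((l : ℤ) - m).toNat ((l : ℤ) + m).toNat)).eval (Real.cos t)

/-- The ladder function multiplied by the Fourier mode `exp (i m φ)`. -/
def ladderMode (k l : ℕ) (m : ℤ) (p : ℝ × ℝ) : ℂ :=
  (ladder k l m p.1 : ℂ) * Complex.exp (Complex.I * m * p.2)

theorem cos_mem_Ioo {t : ℝ} (ht : t ∈ Set.Ioo 0 Real.pi) :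
    0 < 1 - Real.cos t ∧ 0 < 1 + Real.cos t := by
  have h := Real.sin_pos_of_mem_Ioo ht
  have h2 := Real.sin_sq_add_cos_sq t
  constructor <;> nlinarith [Real.cos_le_one t, Real.neg_one_le_cos t]

theorem halfTan_pos {t : ℝ} (ht : t ∈ Set.Ioo 0 Real.pi) : 0 < halfTan t :=
  div_pos (cos_mem_Ioo ht).1 (Real.sin_pos_of_mem_Ioo ht)

theorem hasDerivAt_halfTan {t : ℝ} (ht : t ∈ Set.Ioo 0 Real.pi) :
    HasDerivAt halfTan (halfTan t / Real.sin t) t := by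
  have hs := (Real.sin_pos_of_mem_Ioo ht).ne'
  have h := ((Real.hasDerivAt_cos t).const_sub 1).div (Real.hasDerivAt_sin t) hs
  refine h.congr_deriv ?_
  rw [halfTan]
  have h2 := Real.sin_sq_add_cos_sq t
  field_simp
  linear_combination h2

theorem hasDerivAt_ladder (k l : ℕ) (m : ℤ) {t : ℝ} (ht : t ∈ Set.Ioo 0 Real.pi) :
    HasDerivAt (ladder k l m)
      (k * Real.cot t * ladder k l m t + m / Real.sin t * ladder k l m t - ladder (k + 1) l m t)
      t := by
  have hs := (Real.sin_pos_of_mem_Ioo ht).ne'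
  have hu := (halfTan_pos ht).ne'
  set r := derivative^[l + k] (jacobiPow ((l : ℤ) - m).toNat ((l : ℤ) + m).toNat) with hr
  have h1 := (Real.hasDerivAt_sin t).pow k
  have h2 := (hasDerivAt_zpow m (halfTan t) (Or.inl hu)).comp t (hasDerivAt_halfTan ht)
  have h3 := (r.hasDerivAt (Real.cos t)).comp t (Real.hasDerivAt_cos t)
  refine ((h1.mul h2).mul h3).congr_deriv ?_
  simp only [ladder, ← hr, ← add_assoc, Function.iterate_succ_apply', Function.comp,
    Pi.mul_apply, Pi.pow_apply]
  rw [zpow_sub_one₀ hu, Real.cot_eq_cos_div_sin]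
  rcases k with _ | k
  · simp; field_simp; ring
  · simp only [Nat.add_sub_cancel]
    push_cast
    field_simp
    ring

theorem deriv_exp_mode (m : ℤ) (c : ℂ) (x : ℝ) :
    deriv (fun t : ℝ => c * Complex.exp (Complex.I * m * t)) x
      = Complex.I * m * (c * Complex.exp (Complex.I * m * x)) := by
  have h : HasDerivAt (fun t : ℝ => Complex.I * m * (t : ℂ)) (Complex.I * m * 1) x :=
    (Complex.ofRealCLM.hasDerivAt (x := x)).const_mul _
  rw [(h.cexp.const_mul c).deriv]
  ring

/-- The spherical coordinates of the points other than the poles, without restriction on `φ`. -/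
def polarStrip : Set (ℝ × ℝ) := Set.Ioo 0 Real.pi ×ˢ Set.univ

theorem eth_eq_of_eqOn_ladderMode (k l : ℕ) (m : ℤ) (c : ℂ) (f : ℝ × ℝ → ℂ)
    (hf : ∀ p ∈ polarStrip, f p = c * ladderMode k l m p) :
    ∀ p ∈ polarStrip, eth k f p = c * ladderMode (k + 1) l m p := by
  rintro ⟨t, x⟩ hp
  have ht : t ∈ Set.Ioo 0 Real.pi := hp.1
  have hs : (Real.sin t : ℂ) ≠ 0 := by exact_mod_cast (Real.sin_pos_of_mem_Ioo ht).ne'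
  have e1 : dTheta f (t, x) = c * ((k * Real.cot t * ladder k l m t + m / Real.sin t * ladder k l m t
      - ladder (k + 1) l m t : ℝ) * Complex.exp (Complex.I * m * x)) := by
    have : (fun t : ℝ => f (t, x)) =ᶠ[nhds t]
        fun t => c * ((ladder k l m t : ℂ) * Complex.exp (Complex.I * m * x)) := by
      filter_upwards [isOpen_Ioo.mem_nhds ht] with r hr
      exact hf (r, x) ⟨hr, trivial⟩
    rw [dTheta, this.deriv_eq]
    exact (((hasDerivAt_ladder k l m ht).ofReal_comp.mul_const _).const_mul c).deriv
  have e2 : dPhi f (t, x) = Complex.I * m * (c * ladderMode k l m (t, x)) := by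
    have : (fun y : ℝ => f (t, y))
        = fun y : ℝ => (c * ladder k l m t) * Complex.exp (Complex.I * m * y) := by
      funext y
      rw [hf (t, y) ⟨ht, trivial⟩, ladderMode]
      ring
    rw [dPhi]
    simp only [this, deriv_exp_mode]
    rw [ladderMode, mul_assoc c]
  rw [eth, e1, e2, hf _ hp]
  simp only [ladderMode]
  push_cast
  have hI := Complex.I_sq
  field_simp
  linear_combination (-(c * m * ladder k l m t / Complex.sin t)) * hI

theorem ethPow_eq_ladderMode (k l : ℕ) (m : ℤ) (c : ℂ) (f : ℝ × ℝ → ℂ)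
    (hf : ∀ p ∈ polarStrip, f p = c * ladderMode 0 l m p) :
    ∀ p ∈ polarStrip, ethPow k f p = c * ladderMode k l m p := by
  induction k with
  | zero => exact hf
  | succ k ih => exact eth_eq_of_eqOn_ladderMode k l m c _ ih

theorem ethBarPow_conj (k : ℕ) (f : ℝ × ℝ → ℂ) :
    ethBarPow k (fun p => (starRingEnd ℂ) (f p)) = fun p => (starRingEnd ℂ) (ethPow k f p) := by
  induction k with
  | zero => rfl
  | succ k ih =>
    funext p
    simp only [ethBarPow, ethPow, ih]
    have h1 : dTheta (fun p => (starRingEnd ℂ) (ethPow k f p)) p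
        = (starRingEnd ℂ) (dTheta (ethPow k f) p) := deriv.star
    have h2 : dPhi (fun p => (starRingEnd ℂ) (ethPow k f p)) p
        = (starRingEnd ℂ) (dPhi (ethPow k f) p) := deriv.star
    simp only [ethBar, eth, h1, h2, map_neg, map_sub, map_add, map_mul, map_div₀, Complex.conj_I,
      Complex.conj_ofReal]
    push_cast
    simp
    ring

/-! ### The spherical harmonics as ladder functions -/

theorem legendrePoly_eq (l : ℕ) :
    legendrePoly l = C (1 / (2 ^ l * (l.factorial : ℝ))) * derivative^[l] (jacobiPow l l) := by
  rw [legendrePoly, jacobiPow, ← mul_pow]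
  congr 3
  ring

theorem assocLegendre_cos (l n : ℕ) {t : ℝ} (ht : t ∈ Set.Ioo 0 Real.pi) :
    assocLegendre l n (Real.cos t) = Real.sin t ^ n * (1 / (2 ^ l * (l.factorial : ℝ)) *
      (derivative^[l + n] (jacobiPow l l)).eval (Real.cos t)) := by
  have h : Real.sqrt (1 - Real.cos t ^ 2) = Real.sin t := by
    rw [← Real.sin_sq, Real.sqrt_sq (Real.sin_pos_of_mem_Ioo ht).le]
  rw [assocLegendre, h, legendrePoly_eq, iterate_derivative_C_mul, ← Function.iterate_add_apply,
    eval_mul, eval_C, add_comm n l]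

theorem sin_eq_halfTan_mul {t : ℝ} (ht : t ∈ Set.Ioo 0 Real.pi) :
    Real.sin t = halfTan t * (1 + Real.cos t) := by
  have hs := (Real.sin_pos_of_mem_Ioo ht).ne'
  rw [halfTan]
  field_simp
  linear_combination Real.sin_sq_add_cos_sq t

theorem sin_eq_inv_halfTan_mul {t : ℝ} (ht : t ∈ Set.Ioo 0 Real.pi) :
    Real.sin t = (halfTan t)⁻¹ * (1 - Real.cos t) := by
  have hs := (Real.sin_pos_of_mem_Ioo ht).ne'
  have hc := (cos_mem_Ioo ht).1.ne'
  rw [halfTan]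
  field_simp

theorem assocLegendre_eq_ladder (l n : ℕ) (hn : n ≤ l) {t : ℝ} (ht : t ∈ Set.Ioo 0 Real.pi) :
    assocLegendre l n (Real.cos t) = 1 / (2 ^ l * (l - n).factorial) * ladder 0 l n t := by
  obtain ⟨c, rfl⟩ := Nat.exists_eq_add_of_le' hn
  have h := congrArg (eval (Real.cos t))
    (X_add_one_pow_mul_iterate_derivative_jacobiPow n (c + n) c)
  simp only [eval_mul, eval_pow, eval_add, eval_X, eval_one, eval_natCast] at h
  have e1 : (((c + n : ℕ) : ℤ) - n).toNat = c := by omega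
  have e2 : (((c + n : ℕ) : ℤ) + n).toNat = c + n + n := by omega
  rw [assocLegendre_cos _ _ ht, ladder, e1, e2, Nat.add_sub_cancel, sin_eq_halfTan_mul ht]
  have hc : (c.factorial : ℝ) ≠ 0 := by positivity
  have hcn : ((c + n).factorial : ℝ) ≠ 0 := by positivity
  simp only [mul_pow, pow_zero, one_mul, add_zero, zpow_natCast]
  field_simp
  rw [add_comm (1 : ℝ)]
  linear_combination halfTan t ^ n * h

theorem assocLegendre_eq_ladder_neg (l n : ℕ) (hn : n ≤ l) {t : ℝ} (ht : t ∈ Set.Ioo 0 Real.pi) :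
    assocLegendre l n (Real.cos t)
      = (-1) ^ n / (2 ^ l * (l - n).factorial) * ladder 0 l (-n) t := by
  obtain ⟨c, rfl⟩ := Nat.exists_eq_add_of_le' hn
  have h := congrArg (eval (Real.cos t))
    (X_sub_one_pow_mul_iterate_derivative_jacobiPow n (c + n) c)
  simp only [eval_mul, eval_pow, eval_sub, eval_X, eval_one, eval_natCast] at h
  have e1 : (((c + n : ℕ) : ℤ) - -n).toNat = c + n + n := by omega
  have e2 : (((c + n : ℕ) : ℤ) + -n).toNat = c := by omega
  rw [assocLegendre_cos _ _ ht, ladder, e1, e2, Nat.add_sub_cancel]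
  have hs : Real.sin t ^ n = (-1) ^ n * (halfTan t ^ (-(n : ℤ)) * (Real.cos t - 1) ^ n) := by
    rw [sin_eq_inv_halfTan_mul ht, zpow_neg, zpow_natCast, ← inv_pow, ← mul_pow, ← mul_pow]
    ring
  have hc : (c.factorial : ℝ) ≠ 0 := by positivity
  have hcn : ((c + n).factorial : ℝ) ≠ 0 := by positivity
  rw [hs]
  simp only [pow_zero, one_mul, add_zero]
  generalize halfTan t ^ (-(n : ℤ)) = z
  field_simp
  linear_combination z * h

theorem exists_sphHarmonic_eq_ladderMode (l : ℕ) (m : ℤ) (hm : |m| ≤ l) :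
    ∃ c : ℂ, ‖c‖ ^ 2 = (2 * l + 1) / (4 * Real.pi * 4 ^ l *
        (((l : ℤ) - m).toNat.factorial * ((l : ℤ) + m).toNat.factorial)) ∧
      ∀ p ∈ polarStrip, sphHarmonic l m p = c * ladderMode 0 l m p := by
  have hsq : ∀ n : ℕ, n ≤ l → (Real.sqrt ((2 * l + 1) / (4 * Real.pi) *
      ((l - n).factorial / (l + n).factorial)) * (1 / (2 ^ l * (l - n).factorial))) ^ 2
      = (2 * l + 1) / (4 * Real.pi * 4 ^ l * ((l - n).factorial * (l + n).factorial)) := by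
    intro n hn
    rw [mul_pow, Real.sq_sqrt (by positivity)]
    have h1 : ((l - n).factorial : ℝ) ≠ 0 := by positivity
    have h2 : ((l + n).factorial : ℝ) ≠ 0 := by positivity
    have h3 : (4 : ℝ) ^ l = (2 ^ l) ^ 2 := by rw [← pow_mul, mul_comm, pow_mul]; norm_num
    rw [h3]
    have := Real.pi_ne_zero
    field_simp
  rw [abs_le] at hm
  rcases le_or_gt 0 m with h0 | h0
  · lift m to ℕ using h0
    have hn : m ≤ l := by omega
    refine ⟨(-1) ^ m * (Real.sqrt ((2 * l + 1) / (4 * Real.pi) *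
      ((l - m).factorial / (l + m).factorial)) * (1 / (2 ^ l * (l - m).factorial)) : ℝ), ?_, ?_⟩
    · rw [norm_mul, norm_pow, norm_neg, norm_one, one_pow, one_mul, Complex.norm_real,
        Real.norm_eq_abs, sq_abs, hsq m hn, show ((l : ℤ) - m).toNat = l - m by omega,
        show ((l : ℤ) + m).toNat = l + m by omega]
    · rintro ⟨t, x⟩ hp
      rw [sphHarmonic, if_pos (by omega), sphHarmonicNat, Int.toNat_natCast]
      simp only
      rw [assocLegendre_eq_ladder l m hn hp.1, ladderMode]
      push_cast
      ring
  · obtain ⟨n, rfl⟩ : ∃ n : ℕ, m = -n := ⟨(-m).toNat, by omega⟩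
    have hn : n ≤ l := by omega
    refine ⟨(Real.sqrt ((2 * l + 1) / (4 * Real.pi) *
      ((l - n).factorial / (l + n).factorial)) * (1 / (2 ^ l * (l - n).factorial)) : ℝ), ?_, ?_⟩
    · rw [Complex.norm_real,
        Real.norm_eq_abs, sq_abs, hsq n hn, show ((l : ℤ) - -n).toNat = l + n by omega,
        show ((l : ℤ) + -n).toNat = l - n by omega, mul_comm ((l + n).factorial : ℝ)]
    · rintro ⟨t, x⟩ hp
      rw [sphHarmonic, if_neg (by omega), sphHarmonicNat, neg_neg, Int.toNat_natCast]
      simp only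
      rw [assocLegendre_eq_ladder_neg l n hn hp.1, ladderMode]
      simp only [map_mul, map_pow, map_neg, map_one, Complex.conj_ofReal, ← Complex.exp_conj,
        Complex.conj_I, Complex.conj_natCast]
      have h1 : ((-1 : ℂ) ^ n) ^ 2 = 1 := by rw [← pow_mul, mul_comm, pow_mul]; norm_num
      push_cast
      rw [show -Complex.I * n * x = Complex.I * -n * x by ring]
      linear_combination ((Real.sqrt ((2 * l + 1) / (4 * Real.pi) *
        ((l - n).factorial / (l + n).factorial)) : ℂ) * (1 / (2 ^ l * (l - n).factorial)) *
        (ladder 0 l (-n) t) * Complex.exp (Complex.I * -n * x)) * h1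

theorem sphHarmonic_conj (l : ℕ) (m : ℤ) :
    sphHarmonic l m = fun p => (starRingEnd ℂ) (sphHarmonic l (-m) p) := by
  funext p
  rcases lt_trichotomy m 0 with h | rfl | h
  · rw [sphHarmonic, sphHarmonic, if_neg (by omega), if_pos (by omega)]
  · simp [sphHarmonic, sphHarmonicNat]
  · rw [sphHarmonic, sphHarmonic, if_pos (by omega), if_neg (by omega), neg_neg, Complex.conj_conj]

/-! ### The norm of the ladder functions -/

theorem integral_eval_cos_mul_sin (p : ℝ[X]) :
    ∫ t in (0 : ℝ)..Real.pi, p.eval (Real.cos t) * Real.sin t = ∫ t in (-1 : ℝ)..1, p.eval t := by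
  have h := intervalIntegral.integral_comp_mul_deriv (a := 0) (b := Real.pi)
    (fun t _ => Real.hasDerivAt_cos t) Real.continuous_sin.neg.continuousOn p.continuous
  rw [Real.cos_zero, Real.cos_pi, intervalIntegral.integral_symm (-1)] at h
  simp only [Function.comp, mul_neg, intervalIntegral.integral_neg, neg_inj] at h
  exact h

theorem ladder_sq (k l : ℕ) (m : ℤ) (hk : k ≤ l) (hm : |m| ≤ l) {t : ℝ}
    (ht : t ∈ Set.Ioo 0 Real.pi) :
    ladder k l m t ^ 2
      = (-1) ^ (l + k + ((l : ℤ) - m).toNat) * ((l + k).factorial / (l - k).factorial) *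
        ((derivative^[l + k] (jacobiPow ((l : ℤ) - m).toNat ((l : ℤ) + m).toNat)).eval (Real.cos t) *
          (derivative^[l - k] (jacobiPow ((l : ℤ) + m).toNat ((l : ℤ) - m).toNat)).eval
            (Real.cos t)) := by
  rw [abs_le] at hm
  obtain ⟨hx, hy⟩ := cos_mem_Ioo ht
  rw [ladder]
  set a := ((l : ℤ) - m).toNat with ha
  set b := ((l : ℤ) + m).toNat with hb
  have hab : a + b = 2 * l := by omega
  have h := iterate_derivative_jacobiPow_reflect (Real.cos t) (by linarith) (by linarith)
    a b (l + k) (by omega)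
  rw [show a + b - (l + k) = l - k by omega] at h
  set c := Real.cos t
  set H := (derivative^[l + k] (jacobiPow a b)).eval c
  set K := (derivative^[l - k] (jacobiPow b a)).eval c
  have hz : (halfTan t ^ m) ^ 2 * ((1 - c) ^ a * (1 + c) ^ b) = ((1 - c) * (1 + c)) ^ l := by
    have hq : halfTan t ^ 2 = (1 - c) / (1 + c) := by
      have h1 := sin_eq_halfTan_mul ht
      have hs := (Real.sin_pos_of_mem_Ioo ht).ne'
      have : halfTan t * Real.sin t = 1 - c := by rw [halfTan]; field_simp; rfl
      rw [eq_div_iff hy.ne', ← this]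
      rw [h1]; ring
    rw [← zpow_natCast (halfTan t ^ m) 2, zpow_comm, zpow_natCast, hq, div_zpow,
      ← zpow_natCast (1 - c) a, ← zpow_natCast (1 + c) b,
      show (a : ℤ) = l - m by omega, show (b : ℤ) = l + m by omega, zpow_sub₀ hx.ne',
      zpow_add₀ hy.ne', mul_pow, zpow_natCast, zpow_natCast]
    have := zpow_ne_zero m hx.ne'
    have := zpow_ne_zero m hy.ne'
    field_simp
  have hs : (Real.sin t ^ k) ^ 2 = ((1 - c) * (1 + c)) ^ k := by
    rw [← pow_mul, mul_comm, pow_mul, Real.sin_sq]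
    congr 1
    ring
  have hf : ((l - k).factorial : ℝ) ≠ 0 := by positivity
  have e1 : (c - 1) * (c + 1) = -1 * ((1 - c) * (1 + c)) := by ring
  have e2 : c - 1 = -1 * (1 - c) := by ring
  rw [e1, e2, mul_pow, mul_pow (-1 : ℝ), add_comm c 1] at h
  have h2 : ((-1 : ℝ) ^ (l + k)) ^ 2 = 1 := by rw [← pow_mul, mul_comm, pow_mul]; norm_num
  have hne : (1 - c) ^ a * (1 + c) ^ b ≠ 0 := by positivity
  rw [mul_pow, mul_pow, hs]
  apply mul_right_cancel₀ hne
  rw [show ((1 - c) * (1 + c)) ^ k * (halfTan t ^ m) ^ 2 * H ^ 2 * ((1 - c) ^ a * (1 + c) ^ b)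
    = ((1 - c) * (1 + c)) ^ (l + k) * H ^ 2 by rw [pow_add, ← hz]; ring, pow_add (-1 : ℝ)]
  have h3 : ((1 - c) * (1 + c)) ^ (l + k) * H = (-1) ^ (l + k) * (-1) ^ a *
      ((l + k).factorial / (l - k).factorial) * K * ((1 - c) ^ a * (1 + c) ^ b) := by
    generalize ((1 - c) * (1 + c)) ^ (l + k) = w at *
    field_simp
    generalize (-1 : ℝ) ^ (l + k) = δ at *
    linear_combination δ * h - ((l - k).factorial * w * H) * h2
  linear_combination H * h3

theorem integral_ladder_sq (k l : ℕ) (m : ℤ) (hk : k ≤ l) (hm : |m| ≤ l) :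
    ∫ t in (0 : ℝ)..Real.pi, ladder k l m t ^ 2 * Real.sin t
      = (l + k).factorial / (l - k).factorial *
        (2 ^ (2 * l + 1) * ((l : ℤ) - m).toNat.factorial * ((l : ℤ) + m).toNat.factorial /
          (2 * l + 1)) := by
  have hm' := hm
  rw [abs_le] at hm'
  set a := ((l : ℤ) - m).toNat with ha
  set b := ((l : ℤ) + m).toNat with hb
  have hab : a + b = 2 * l := by omega
  have hab' : (a : ℝ) + b = 2 * l := by exact_mod_cast hab
  have h1 := integral_eval_cos_mul_sin
    (derivative^[l + k] (jacobiPow a b) * derivative^[l - k] (jacobiPow b a))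
  have h2 := integral_iterate_derivative_jacobiPow_mul a b (l - k) (by omega)
  rw [show a + b - (l - k) = l + k by omega] at h2
  simp only [eval_mul] at h1
  rw [h2] at h1
  have h3 : ∫ t in (0 : ℝ)..Real.pi, ladder k l m t ^ 2 * Real.sin t
      = ∫ t in (0 : ℝ)..Real.pi, ((-1) ^ (l + k + a) * ((l + k).factorial / (l - k).factorial)) *
        (eval (Real.cos t) (derivative^[l + k] (jacobiPow a b)) *
          eval (Real.cos t) (derivative^[l - k] (jacobiPow b a)) * Real.sin t) := by
    rw [intervalIntegral.integral_of_le Real.pi_pos.le,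
      intervalIntegral.integral_of_le Real.pi_pos.le, integral_Ioc_eq_integral_Ioo,
      integral_Ioc_eq_integral_Ioo]
    refine setIntegral_congr_fun measurableSet_Ioo fun t ht => ?_
    rw [ladder_sq k l m hk hm ht]
    ring
  rw [h3, intervalIntegral.integral_const_mul, h1, hab, hab']
  have hsign : (-1 : ℝ) ^ (l + k + a) * (-1) ^ (l - k + b) = 1 := by
    rw [← pow_add, show l + k + a + (l - k + b) = 2 * (2 * l) by omega, pow_mul]
    norm_num
  linear_combination ((l + k).factorial / (l - k).factorial *
    (2 ^ (2 * l + 1) * a.factorial * b.factorial / (2 * l + 1)) : ℝ) * hsign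

/-! ### The spin weighted harmonics away from the poles -/

theorem continuousOn_ladder (k l : ℕ) (m : ℤ) :
    ContinuousOn (ladder k l m) (Set.Ioo 0 Real.pi) :=
  fun _ ht => (hasDerivAt_ladder k l m ht).continuousAt.continuousWithinAt

theorem spinHarmonicInterior_eq (s : ℤ) (l : ℕ) (m : ℤ) (hs : |s| ≤ l) (hm : |m| ≤ l) :
    ∃ g : ℝ → ℂ, ContinuousOn g (Set.Ioo 0 Real.pi) ∧
      (∫ t in (0 : ℝ)..Real.pi, ‖g t‖ ^ 2 * Real.sin t = 1 / (2 * Real.pi)) ∧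
      ∀ p ∈ polarStrip, spinHarmonicInterior s l m p
        = g p.1 * Complex.exp (Complex.I * m * p.2) := by
  have key : ∀ (k : ℕ) (n : ℤ) (C c : ℂ), k ≤ l → |n| ≤ l →
      ‖C‖ ^ 2 = (l - k).factorial / (l + k).factorial →
      ‖c‖ ^ 2 = (2 * l + 1) / (4 * Real.pi * 4 ^ l *
        (((l : ℤ) - n).toNat.factorial * ((l : ℤ) + n).toNat.factorial)) →
      ContinuousOn (fun t => C * c * ladder k l n t) (Set.Ioo 0 Real.pi) ∧
      (∫ t in (0 : ℝ)..Real.pi, ‖C * c * ladder k l n t‖ ^ 2 * Real.sin t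
        = 1 / (2 * Real.pi)) := by
    intro k n C c hk hn hC hc
    refine ⟨continuousOn_const.mul
      (Complex.continuous_ofReal.comp_continuousOn (continuousOn_ladder k l n)), ?_⟩
    have : ∀ t, ‖C * c * ladder k l n t‖ ^ 2 * Real.sin t
        = (‖C‖ ^ 2 * ‖c‖ ^ 2) * (ladder k l n t ^ 2 * Real.sin t) := by
      intro t
      rw [norm_mul, norm_mul, Complex.norm_real, Real.norm_eq_abs, mul_pow, mul_pow, sq_abs]
      ring
    rw [funext this, intervalIntegral.integral_const_mul, integral_ladder_sq k l n hk hn, hC, hc]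
    have h3 : (2 : ℝ) ^ (2 * l + 1) = 2 * 4 ^ l := by rw [pow_succ, pow_mul]; norm_num; ring
    rw [h3]
    have := Real.pi_ne_zero
    have h4 : (2 * (l : ℝ) + 1) ≠ 0 := by positivity
    field_simp
    norm_num
  rw [abs_le] at hs
  rcases le_or_gt 0 s with h0 | h0
  · lift s to ℕ using h0
    obtain ⟨c, hc, hY⟩ := exists_sphHarmonic_eq_ladderMode l m hm
    have hk := key s m (Real.sqrt ((((l : ℤ) - s).toNat.factorial : ℝ) /
      (((l : ℤ) + s).toNat.factorial : ℝ)) : ℂ) c (by omega) hm ?_ hc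
    · refine ⟨_, hk.1, hk.2, fun p hp => ?_⟩
      rw [spinHarmonicInterior, if_pos (by omega), Int.toNat_natCast,
        ethPow_eq_ladderMode s l m c _ hY p hp, ladderMode]
      ring
    · rw [Complex.norm_real, Real.norm_eq_abs, sq_abs, Real.sq_sqrt (by positivity),
        show ((l : ℤ) - s).toNat = l - s by omega, show ((l : ℤ) + s).toNat = l + s by omega]
  · obtain ⟨k, rfl⟩ : ∃ k : ℕ, s = -k := ⟨(-s).toNat, by omega⟩
    have hm' : |-m| ≤ (l : ℤ) := by rwa [abs_neg]
    obtain ⟨c, hc, hY⟩ := exists_sphHarmonic_eq_ladderMode l (-m) hm'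
    have hk := key k (-m) ((Real.sqrt ((((l : ℤ) + -k).toNat.factorial : ℝ) /
      (((l : ℤ) - -k).toNat.factorial : ℝ)) : ℂ) * (-1) ^ (-(k : ℤ))) ((starRingEnd ℂ) c)
      (by omega) hm' ?_ ?_
    · refine ⟨_, hk.1, hk.2, fun p hp => ?_⟩
      rw [spinHarmonicInterior, if_neg (by omega), neg_neg, Int.toNat_natCast, sphHarmonic_conj,
        ethBarPow_conj]
      simp only
      rw [ethPow_eq_ladderMode k l (-m) c _ hY p hp, ladderMode]
      simp only [map_mul, Complex.conj_ofReal, ← Complex.exp_conj, Complex.conj_I, map_intCast]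
      push_cast
      rw [show -Complex.I * -m * p.2 = Complex.I * m * p.2 by ring]
      ring
    · rw [norm_mul, norm_zpow, norm_neg, norm_one, one_zpow, mul_one,
        Complex.norm_real, Real.norm_eq_abs, sq_abs, Real.sq_sqrt (by positivity),
        show ((l : ℤ) + -k).toNat = l - k by omega, show ((l : ℤ) - -k).toNat = l + k by omega]
    · rw [RCLike.norm_conj, hc]

theorem exists_spinHarmonic_eq (s : ℤ) (l : ℕ) (m : ℤ) (hs : |s| ≤ l) (hm : |m| ≤ l) :
    ∃ g : ℝ → ℂ, ContinuousOn g (Set.Ioo 0 Real.pi) ∧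
      (∫ t in (0 : ℝ)..Real.pi, ‖g t‖ ^ 2 * Real.sin t = 1 / (2 * Real.pi)) ∧
      ∀ p ∈ polarStrip, spinHarmonic s l m p = g p.1 * Complex.exp (Complex.I * m * p.2) := by
  obtain ⟨g, hg, hn, h⟩ := spinHarmonicInterior_eq s l m hs hm
  refine ⟨g, hg, hn, fun p hp => ?_⟩
  rw [← h p hp, spinHarmonic]
  refine extendFrom_extends ?_ p hp
  refine ContinuousOn.congr (f := fun p : ℝ × ℝ => g p.1 * Complex.exp (Complex.I * m * p.2)) ?_ h
  refine (hg.comp continuousOn_fst fun p hp => hp.1).mul ?_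
  fun_prop

end PolynomialIdentities

/-! ### The surface measure as a product measure -/

/-- The measure `sin ϑ dϑ` on `[0, π]`. -/
def thetaMeasure : Measure ℝ :=
  ((volume : Measure ℝ).restrict (Set.Icc 0 Real.pi)).withDensity
    (fun t => ENNReal.ofReal (Real.sin t))

/-- The measure `dφ` on `[0, 2π)`. -/
def phiMeasure : Measure ℝ := (volume : Measure ℝ).restrict (Set.Ico 0 (2 * Real.pi))

instance isFiniteMeasure_phiMeasure : IsFiniteMeasure phiMeasure := by
  rw [phiMeasure]; infer_instance

instance isFiniteMeasure_thetaMeasure : IsFiniteMeasure thetaMeasure := by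
  refine isFiniteMeasure_withDensity_ofReal ?_
  exact (Real.continuous_sin.integrableOn_Icc (a := 0) (b := Real.pi)).2

theorem sigma_eq_prod : sigma = thetaMeasure.prod phiMeasure := by
  rw [sigma, thetaMeasure, phiMeasure, prod_withDensity_left (by fun_prop), Measure.prod_restrict]
  rfl

theorem ae_thetaMeasure_mem_Ioo : ∀ᵐ t ∂thetaMeasure, t ∈ Set.Ioo 0 Real.pi := by
  refine (withDensity_absolutelyContinuous _ _).ae_le ?_
  rw [← restrict_Ioo_eq_restrict_Icc]
  exact ae_restrict_mem measurableSet_Ioo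

theorem ae_sigma_mem_Ioo_prod : ∀ᵐ p ∂sigma, p ∈ Set.Ioo 0 Real.pi ×ˢ Set.Ico 0 (2 * Real.pi) := by
  rw [sigma_eq_prod]
  have h1 := Measure.quasiMeasurePreserving_fst (μ := thetaMeasure) (ν := phiMeasure) |>.ae
    ae_thetaMeasure_mem_Ioo
  have h2 := Measure.quasiMeasurePreserving_snd (μ := thetaMeasure) (ν := phiMeasure) |>.ae
    (ae_restrict_mem (μ := volume) (measurableSet_Ico (a := (0 : ℝ)) (b := 2 * Real.pi)))
  filter_upwards [h1, h2] with p hp1 hp2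
  exact ⟨hp1, hp2⟩

theorem ae_sigma_mem_polarStrip : ∀ᵐ p ∂sigma, p ∈ polarStrip := by
  filter_upwards [ae_sigma_mem_Ioo_prod] with p hp
  exact ⟨hp.1, trivial⟩

theorem integral_thetaMeasure (f : ℝ → ℝ) :
    ∫ t, f t ∂thetaMeasure = ∫ t in (0 : ℝ)..Real.pi, f t * Real.sin t := by
  rw [thetaMeasure, integral_withDensity_eq_integral_toReal_smul (by fun_prop) (by simp),
    integral_Icc_eq_integral_Ioc, intervalIntegral.integral_of_le Real.pi_pos.le]
  refine setIntegral_congr_fun measurableSet_Ioc fun t ht => ?_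
  simp only [smul_eq_mul]
  rw [ENNReal.toReal_ofReal (Real.sin_nonneg_of_nonneg_of_le_pi ht.1.le ht.2), mul_comm]

theorem integral_phiMeasure_exp (n : ℤ) :
    ∫ x : ℝ, Complex.exp (Complex.I * n * x) ∂phiMeasure
      = if n = 0 then (2 * Real.pi : ℂ) else 0 := by
  rw [phiMeasure, integral_Ico_eq_integral_Ioc,
    ← intervalIntegral.integral_of_le (by positivity)]
  split_ifs with h
  · simp [h]
  · have hc : Complex.I * n ≠ 0 := mul_ne_zero Complex.I_ne_zero (by exact_mod_cast h)
    rw [integral_exp_mul_complex hc]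
    have : Complex.I * n * ((2 * Real.pi : ℝ) : ℂ) = n * (2 * Real.pi * Complex.I) := by
      push_cast; ring
    rw [this, Complex.exp_int_mul_two_pi_mul_I]
    simp

/-! ### Orthonormality -/

theorem norm_exp_mode (m : ℤ) (x : ℝ) : ‖Complex.exp (Complex.I * m * x)‖ = 1 := by
  rw [show Complex.I * m * x = ((m * x : ℝ) : ℂ) * Complex.I by push_cast; ring,
    Complex.norm_exp_ofReal_mul_I]

theorem memLp_spinHarmonic (s : ℤ) (l : ℕ) (m : ℤ) (hs : |s| ≤ l) (hm : |m| ≤ l) :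
    MemLp (spinHarmonic s l m) 2 sigma := by
  obtain ⟨g, hg, hn, h⟩ := exists_spinHarmonic_eq s l m hs hm
  have hae : (fun p : ℝ × ℝ => g p.1 * Complex.exp (Complex.I * m * p.2)) =ᵐ[sigma]
      spinHarmonic s l m := by
    filter_upwards [ae_sigma_mem_polarStrip] with p hp using (h p hp).symm
  refine MemLp.ae_eq hae ?_
  have hgm : AEStronglyMeasurable g thetaMeasure := by
    have h1 : AEStronglyMeasurable g (volume.restrict (Set.Ioo 0 Real.pi)) :=
      hg.aestronglyMeasurable measurableSet_Ioo
    rw [restrict_Ioo_eq_restrict_Icc] at h1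
    exact h1.mono_ac (withDensity_absolutelyContinuous _ _)
  have hGm : AEStronglyMeasurable (fun p : ℝ × ℝ => g p.1 * Complex.exp (Complex.I * m * p.2))
      sigma := by
    rw [sigma_eq_prod]
    exact hgm.comp_fst.mul (Continuous.aestronglyMeasurable (by fun_prop))
  rw [memLp_two_iff_integrable_sq_norm hGm]
  simp only [norm_mul, norm_exp_mode, mul_one]
  rw [sigma_eq_prod]
  refine Integrable.comp_fst (f := fun t => ‖g t‖ ^ 2) ?_ phiMeasure
  by_contra hcon
  have := integral_undef hcon
  rw [integral_thetaMeasure, hn] at this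
  exact (by positivity : (1 : ℝ) / (2 * Real.pi) ≠ 0) this

theorem integral_conj_spinHarmonic_mul (s : ℤ) (l : ℕ) (m n : ℤ) (hs : |s| ≤ l) (hm : |m| ≤ l)
    (hn : |n| ≤ l) :
    ∫ y, (starRingEnd ℂ) (spinHarmonic s l m y) * spinHarmonic s l n y ∂sigma
      = if m = n then 1 else 0 := by
  obtain ⟨g, -, hgn, h⟩ := exists_spinHarmonic_eq s l m hs hm
  obtain ⟨g', -, -, h'⟩ := exists_spinHarmonic_eq s l n hs hn
  have hae : (fun y => (starRingEnd ℂ) (spinHarmonic s l m y) * spinHarmonic s l n y) =ᵐ[sigma]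
      fun p => ((starRingEnd ℂ) (g p.1) * g' p.1) *
        Complex.exp (Complex.I * (n - m : ℤ) * p.2) := by
    filter_upwards [ae_sigma_mem_polarStrip] with p hp
    rw [h p hp, h' p hp]
    simp only [map_mul, ← Complex.exp_conj, Complex.conj_I, Complex.conj_ofReal, map_intCast]
    rw [mul_mul_mul_comm, ← Complex.exp_add]
    congr 2
    push_cast
    ring
  rw [integral_congr_ae hae, sigma_eq_prod,
    integral_prod_mul (fun t => (starRingEnd ℂ) (g t) * g' t)
      (fun x : ℝ => Complex.exp (Complex.I * (n - m : ℤ) * x)), integral_phiMeasure_exp]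
  rcases eq_or_ne m n with rfl | hmn
  · have hgg : ∀ᵐ t ∂thetaMeasure, (starRingEnd ℂ) (g t) * g' t = ((‖g t‖ ^ 2 : ℝ) : ℂ) := by
      filter_upwards [ae_thetaMeasure_mem_Ioo] with t ht
      have h1 := h (t, 0) ⟨ht, trivial⟩
      have h2 := h' (t, 0) ⟨ht, trivial⟩
      simp only [Complex.ofReal_zero, mul_zero, Complex.exp_zero, mul_one] at h1 h2
      rw [← h2, h1, mul_comm, Complex.mul_conj, Complex.normSq_eq_norm_sq]
    rw [integral_congr_ae hgg, integral_complex_ofReal, integral_thetaMeasure, hgn]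
    have : (Real.pi : ℂ) ≠ 0 := by exact_mod_cast Real.pi_ne_zero
    simp only [sub_self, if_true]
    push_cast
    field_simp
  · rw [if_neg (by omega), if_neg hmn, mul_zero]

/-! ### Every square integrable function is the representative of a spin weighted function -/

theorem spherePoint_injOn :
    Set.InjOn spherePoint (Set.Ioo 0 Real.pi ×ˢ Set.Ico 0 (2 * Real.pi)) := by
  rintro ⟨t, x⟩ ⟨ht, hx⟩ ⟨t', x'⟩ ⟨ht', hx'⟩ h
  have h0 := congrFun h 0
  have h1 := congrFun h 1
  have h2 := congrFun h 2
  simp only [spherePoint, Matrix.cons_val_zero, Matrix.cons_val_one, Matrix.cons_val] at h0 h1 h2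
  obtain rfl : t = t' := Real.injOn_cos ⟨ht.1.le, ht.2.le⟩ ⟨ht'.1.le, ht'.2.le⟩ h2
  have hs := (Real.sin_pos_of_mem_Ioo ht).ne'
  have hc := mul_left_cancel₀ hs h0
  have hsn := mul_left_cancel₀ hs h1
  have hang : (x : Real.Angle) = x' := Real.Angle.cos_sin_inj hc hsn
  rw [Real.Angle.angle_eq_iff_two_pi_dvd_sub] at hang
  obtain ⟨k, hk⟩ := hang
  have hpi := Real.pi_pos
  simp only [Set.mem_Ico] at hx hx'
  have hk1 : (k : ℝ) < 1 := by
    by_contra hcon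
    nlinarith
  have hk2 : (-1 : ℝ) < k := by
    by_contra hcon
    nlinarith
  have hk0 : k = 0 := by
    have a1 : k < 1 := by exact_mod_cast hk1
    have a2 : -1 < k := by exact_mod_cast hk2
    omega
  rw [hk0] at hk
  simp only [Int.cast_zero, mul_zero, sub_eq_zero] at hk
  rw [hk]

theorem coordFrame_dotProduct_conj (p : ℝ × ℝ) :
    ∑ j, coordFrame p j * (starRingEnd ℂ) (coordFrame p j) = 2 := by
  have h1 : Complex.sin p.1 ^ 2 + Complex.cos p.1 ^ 2 = 1 := Complex.sin_sq_add_cos_sq _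
  have h2 : Complex.sin p.2 ^ 2 + Complex.cos p.2 ^ 2 = 1 := Complex.sin_sq_add_cos_sq _
  have hI := Complex.I_sq
  simp only [Fin.sum_univ_three, coordFrame, eTheta, ePhi, map_add, map_mul, Complex.conj_I,
    Complex.conj_ofReal, Matrix.cons_val_zero, Matrix.cons_val_one, Matrix.cons_val]
  push_cast
  linear_combination (Complex.cos p.1 ^ 2 - Complex.I ^ 2) * h2 + h1 - hI

/-- A function of spin weight `s` whose coordinate representative is a given function, away from the
poles. -/
def spinLift (s : ℤ) (g : ℝ × ℝ → ℂ) (x : Fin 3 → ℝ) (v : Fin 3 → ℂ) : ℂ :=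
  let p := Function.invFunOn spherePoint (Set.Ioo 0 Real.pi ×ˢ Set.Ico 0 (2 * Real.pi)) x
  ((∑ j, v j * (starRingEnd ℂ) (coordFrame p j)) / 2) ^ s * g p

theorem hasSpinWeight_spinLift (s : ℤ) (g : ℝ × ℝ → ℂ) : HasSpinWeight s (spinLift s g) := by
  intro x v ψ _
  simp only [spinLift, mul_assoc, ← Finset.mul_sum]
  rw [mul_div_assoc, mul_zpow, ← Complex.exp_int_mul]
  rw [show (s : ℂ) * (Complex.I * ψ) = Complex.I * (s * ψ) by ring]
  ring

theorem coordRep_spinLift (s : ℤ) (g : ℝ × ℝ → ℂ) {p : ℝ × ℝ}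
    (hp : p ∈ Set.Ioo 0 Real.pi ×ˢ Set.Ico 0 (2 * Real.pi)) : coordRep (spinLift s g) p = g p := by
  have h : Function.invFunOn spherePoint (Set.Ioo 0 Real.pi ×ˢ Set.Ico 0 (2 * Real.pi))
      (spherePoint p) = p := spherePoint_injOn.leftInvOn_invFunOn hp
  simp only [coordRep, spinLift, h, coordFrame_dotProduct_conj]
  norm_num

theorem mem_spinL2 (s : ℤ) (f : Lp ℂ 2 sigma) : f ∈ spinL2 s := by
  refine ⟨spinLift s f, hasSpinWeight_spinLift s f, ?_⟩
  filter_upwards [ae_sigma_mem_Ioo_prod] with p hp using (coordRep_spinLift s f hp).symm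

/-! ### The reproducing kernel -/

theorem memLp_of_mem_harmonicSpace {s : ℤ} {l : ℕ} (hs : |s| ≤ l) {g : ℝ × ℝ → ℂ}
    (hg : g ∈ harmonicSpace s l) : MemLp g 2 sigma := by
  induction hg using Submodule.span_induction with
  | mem x hx =>
    obtain ⟨m, hm, rfl⟩ := hx
    exact memLp_spinHarmonic s l m hs (abs_le.2 hm)
  | zero => exact MemLp.zero
  | add x y _ _ hx hy => exact hx.add hy
  | smul c x _ hx => exact hx.const_smul c

theorem spinHarmonic_mem_harmonicSpace (s : ℤ) (l : ℕ) {m : ℤ} (hm : m ∈ Finset.Icc (-(l : ℤ)) l) :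
    spinHarmonic s l m ∈ harmonicSpace s l :=
  Submodule.subset_span ⟨m, Finset.mem_Icc.1 hm, rfl⟩

theorem kernel_mem_harmonicSpace (s : ℤ) (l : ℕ) (y : ℝ × ℝ) :
    (fun x => kernel s l x y) ∈ harmonicSpace s l := by
  have : (fun x => kernel s l x y) = ∑ m ∈ Finset.Icc (-(l : ℤ)) l,
      (starRingEnd ℂ) (spinHarmonic s l m y) • spinHarmonic s l m := by
    funext x
    simp [kernel, mul_comm]
  rw [this]
  exact Submodule.sum_mem _ fun m hm =>
    Submodule.smul_mem _ _ (spinHarmonic_mem_harmonicSpace s l hm)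

theorem fourierPart_mem_harmonicSpace (s : ℤ) (l : ℕ) (f : ℝ × ℝ → ℂ) :
    fourierPart s l f ∈ harmonicSpace s l := by
  have : fourierPart s l f = ∑ m ∈ Finset.Icc (-(l : ℤ)) l,
      fourierCoeff s l m f • spinHarmonic s l m := by
    funext x
    simp [fourierPart]
  rw [this]
  exact Submodule.sum_mem _ fun m hm =>
    Submodule.smul_mem _ _ (spinHarmonic_mem_harmonicSpace s l hm)

theorem integrable_conj_mul {f g : ℝ × ℝ → ℂ} (hf : MemLp f 2 sigma) (hg : MemLp g 2 sigma) :
    Integrable (fun y => (starRingEnd ℂ) (f y) * g y) sigma :=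
  MemLp.integrable_mul hf.star hg

theorem integrable_conj_spinHarmonic_mul {s : ℤ} {l : ℕ} (hs : |s| ≤ l) {m : ℤ}
    (hm : m ∈ Finset.Icc (-(l : ℤ)) l) {f : ℝ × ℝ → ℂ} (hf : MemLp f 2 sigma) :
    Integrable (fun y => (starRingEnd ℂ) (spinHarmonic s l m y) * f y) sigma :=
  integrable_conj_mul (memLp_spinHarmonic s l m hs (abs_le.2 (Finset.mem_Icc.1 hm))) hf

theorem kernel_mul_eq (s : ℤ) (l : ℕ) (f : ℝ × ℝ → ℂ) (x y : ℝ × ℝ) :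
    kernel s l x y * f y = ∑ m ∈ Finset.Icc (-(l : ℤ)) l,
      spinHarmonic s l m x * ((starRingEnd ℂ) (spinHarmonic s l m y) * f y) := by
  simp only [kernel, Finset.sum_mul, mul_assoc]

theorem integrable_kernel_mul {s : ℤ} {l : ℕ} (hs : |s| ≤ l) {f : ℝ × ℝ → ℂ}
    (hf : MemLp f 2 sigma) (x : ℝ × ℝ) : Integrable (fun y => kernel s l x y * f y) sigma := by
  simp only [kernel_mul_eq]
  exact integrable_finsetSum _ fun m hm => (integrable_conj_spinHarmonic_mul hs hm hf).const_mul _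

theorem kernelConv_eq_fourierPart {s : ℤ} {l : ℕ} (hs : |s| ≤ l) {f : ℝ × ℝ → ℂ}
    (hf : MemLp f 2 sigma) (x : ℝ × ℝ) : kernelConv s l f x = fourierPart s l f x := by
  simp only [kernelConv, kernel_mul_eq]
  rw [integral_finsetSum _ fun m hm => (integrable_conj_spinHarmonic_mul hs hm hf).const_mul _]
  refine Finset.sum_congr rfl fun m _ => ?_
  rw [integral_const_mul, fourierCoeff, mul_comm]

theorem fourierPart_eq_self {s : ℤ} {l : ℕ} (hs : |s| ≤ l) {f : ℝ × ℝ → ℂ}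
    (hf : f ∈ harmonicSpace s l) : fourierPart s l f = f := by
  induction hf using Submodule.span_induction with
  | mem f hf =>
    obtain ⟨n, hn, rfl⟩ := hf
    funext x
    have : ∀ m ∈ Finset.Icc (-(l : ℤ)) l, fourierCoeff s l m (spinHarmonic s l n) *
        spinHarmonic s l m x = if m = n then spinHarmonic s l m x else 0 := by
      intro m hm
      rw [fourierCoeff, integral_conj_spinHarmonic_mul s l m n hs (abs_le.2 (Finset.mem_Icc.1 hm))
        (abs_le.2 hn)]
      split_ifs <;> simp
    rw [fourierPart, Finset.sum_congr rfl this, Finset.sum_ite_eq', if_pos (Finset.mem_Icc.2 hn)]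
  | zero => funext x; simp [fourierPart, fourierCoeff]
  | add f g hf hg hf' hg' =>
    funext x
    rw [Pi.add_apply]
    conv_rhs => rw [← hf', ← hg']
    simp only [fourierPart, ← Finset.sum_add_distrib, ← add_mul]
    refine Finset.sum_congr rfl fun m hm => ?_
    simp only [fourierCoeff, Pi.add_apply, mul_add]
    rw [integral_add (integrable_conj_spinHarmonic_mul hs hm (memLp_of_mem_harmonicSpace hs hf))
      (integrable_conj_spinHarmonic_mul hs hm (memLp_of_mem_harmonicSpace hs hg))]
  | smul c f hf hf' =>
    funext x
    rw [Pi.smul_apply, smul_eq_mul]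
    conv_rhs => rw [← hf']
    simp only [fourierPart, Finset.mul_sum, ← mul_assoc]
    refine Finset.sum_congr rfl fun m hm => ?_
    simp only [fourierCoeff, Pi.smul_apply, smul_eq_mul, mul_left_comm _ c]
    rw [integral_const_mul]

theorem fourierCoeff_fourierPart {s : ℤ} {l : ℕ} (hs : |s| ≤ l) {m : ℤ}
    (hm : m ∈ Finset.Icc (-(l : ℤ)) l) (f : ℝ × ℝ → ℂ) :
    fourierCoeff s l m (fourierPart s l f) = fourierCoeff s l m f := by
  rw [fourierCoeff]
  simp only [fourierPart, Finset.mul_sum, mul_left_comm _ (fourierCoeff _ _ _ f)]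
  have hm' := abs_le.2 (Finset.mem_Icc.1 hm)
  rw [integral_finsetSum _ fun n hn => (integrable_conj_spinHarmonic_mul hs hm
    (memLp_spinHarmonic s l n hs (abs_le.2 (Finset.mem_Icc.1 hn)))).const_mul _]
  have : ∀ n ∈ Finset.Icc (-(l : ℤ)) l, ∫ y, fourierCoeff s l n f *
      ((starRingEnd ℂ) (spinHarmonic s l m y) * spinHarmonic s l n y) ∂sigma
      = if m = n then fourierCoeff s l n f else 0 := by
    intro n hn
    rw [integral_const_mul, integral_conj_spinHarmonic_mul s l m n hs hm'
      (abs_le.2 (Finset.mem_Icc.1 hn))]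
    split_ifs <;> simp
  rw [Finset.sum_congr rfl this, Finset.sum_ite_eq, if_pos hm]

theorem integral_conj_mul_sub_fourierPart {s : ℤ} {l : ℕ} (hs : |s| ≤ l) {f g : ℝ × ℝ → ℂ}
    (hf : MemLp f 2 sigma) (hg : g ∈ harmonicSpace s l) :
    ∫ y, (starRingEnd ℂ) (g y) * (f y - fourierPart s l f y) ∂sigma = 0 := by
  have hp := memLp_of_mem_harmonicSpace hs (fourierPart_mem_harmonicSpace s l f)
  induction hg using Submodule.span_induction with
  | mem g hg =>
    obtain ⟨m, hm, rfl⟩ := hg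
    have hm' := Finset.mem_Icc.2 hm
    have h := fourierCoeff_fourierPart hs hm' f
    simp only [fourierCoeff] at h
    simp only [mul_sub]
    rw [integral_sub (integrable_conj_spinHarmonic_mul hs hm' hf)
      (integrable_conj_spinHarmonic_mul hs hm' hp), h, sub_self]
  | zero => simp
  | add g g' hg hg' h h' =>
    simp only [Pi.add_apply, map_add, add_mul]
    have hi : ∀ k ∈ harmonicSpace s l, Integrable
        (fun y => (starRingEnd ℂ) (k y) * (f y - fourierPart s l f y)) sigma :=
      fun k hk => integrable_conj_mul (memLp_of_mem_harmonicSpace hs hk) (hf.sub hp)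
    rw [integral_add (hi g hg) (hi g' hg'), h, h', add_zero]
  | smul c g hg h =>
    simp only [Pi.smul_apply, smul_eq_mul, map_mul, mul_assoc]
    rw [integral_const_mul, h, mul_zero]

theorem exists_spinL2_ae_eq {s : ℤ} {l : ℕ} (hs : |s| ≤ l) {g : ℝ × ℝ → ℂ}
    (hg : g ∈ harmonicSpace s l) :
    ∃ f : spinL2 s, ((f : Lp ℂ 2 sigma) : ℝ × ℝ → ℂ) =ᵐ[sigma] g :=
  ⟨⟨(memLp_of_mem_harmonicSpace hs hg).toLp g, mem_spinL2 s _⟩,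
    MemLp.coeFn_toLp (memLp_of_mem_harmonicSpace hs hg)⟩

theorem fourierPart_ae_eq_starProjection {s : ℤ} {l : ℕ} (hs : |s| ≤ l) (f : spinL2 s) :
    fourierPart s l ((f : Lp ℂ 2 sigma) : ℝ × ℝ → ℂ) =ᵐ[sigma]
      (((harmonicL2 s l).starProjection f : spinL2 s) : Lp ℂ 2 sigma) := by
  obtain ⟨v, hv⟩ := exists_spinL2_ae_eq hs
    (fourierPart_mem_harmonicSpace s l ((f : Lp ℂ 2 sigma) : ℝ × ℝ → ℂ))
  have hvm : v ∈ harmonicL2 s l := ⟨_, fourierPart_mem_harmonicSpace s l _, hv⟩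
  have : (harmonicL2 s l).starProjection f = v := by
    refine Submodule.eq_starProjection_of_mem_of_inner_eq_zero hvm fun w hw => ?_
    obtain ⟨g, hg, hwg⟩ := hw
    rw [inner_eq_zero_symm, Submodule.coe_inner, L2.inner_def,
      ← integral_conj_mul_sub_fourierPart hs (Lp.memLp (f : Lp ℂ 2 sigma)) hg]
    refine integral_congr_ae ?_
    filter_upwards [hwg, hv, Lp.coeFn_sub (f : Lp ℂ 2 sigma) (v : Lp ℂ 2 sigma)] with y h1 h2 h3
    rw [Submodule.coe_sub, h3, Pi.sub_apply, h1, h2, RCLike.inner_apply, mul_comm]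
  rw [this]
  exact hv.symm

end SpinWeighted

end

theorem mainTheorem4 (s : ℤ) (l : ℕ) (hsl : |s| ≤ (l : ℤ)) :
    -- the functions of `_sH_l` belong to `L²_s`
    (∀ g ∈ SpinWeighted.harmonicSpace s l, ∃ f : SpinWeighted.spinL2 s,
      ((f : MeasureTheory.Lp ℂ 2 SpinWeighted.sigma) : ℝ × ℝ → ℂ)
        =ᵐ[SpinWeighted.sigma] g) ∧
    -- reproducing kernel
    (∀ y ∈ SpinWeighted.coordDomain,
      (fun x => SpinWeighted.kernel s l x y) ∈ SpinWeighted.harmonicSpace s l) ∧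
    (∀ f ∈ SpinWeighted.harmonicSpace s l, ∀ x ∈ SpinWeighted.coordDomain,
      MeasureTheory.Integrable (fun y => SpinWeighted.kernel s l x y * f y) SpinWeighted.sigma ∧
      SpinWeighted.kernelConv s l f x = f x) ∧
    -- orthogonal projection of `L²_s` onto `_sH_l`
    (∀ f : SpinWeighted.spinL2 s,
      (∀ x ∈ SpinWeighted.coordDomain,
        MeasureTheory.Integrable
          (fun y => SpinWeighted.kernel s l x y *
            ((f : MeasureTheory.Lp ℂ 2 SpinWeighted.sigma) : ℝ × ℝ → ℂ) y)
          SpinWeighted.sigma ∧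
        SpinWeighted.kernelConv s l
            ((f : MeasureTheory.Lp ℂ 2 SpinWeighted.sigma) : ℝ × ℝ → ℂ) x
          = SpinWeighted.fourierPart s l
              ((f : MeasureTheory.Lp ℂ 2 SpinWeighted.sigma) : ℝ × ℝ → ℂ) x) ∧
      SpinWeighted.kernelConv s l
          ((f : MeasureTheory.Lp ℂ 2 SpinWeighted.sigma) : ℝ × ℝ → ℂ)
        =ᵐ[SpinWeighted.sigma]
        (((SpinWeighted.harmonicL2 s l).starProjection f : SpinWeighted.spinL2 s) :
          MeasureTheory.Lp ℂ 2 SpinWeighted.sigma)) := by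
  have hconv : ∀ f : SpinWeighted.spinL2 s,
      SpinWeighted.kernelConv s l ((f : MeasureTheory.Lp ℂ 2 SpinWeighted.sigma) : ℝ × ℝ → ℂ)
        = SpinWeighted.fourierPart s l
            ((f : MeasureTheory.Lp ℂ 2 SpinWeighted.sigma) : ℝ × ℝ → ℂ) :=
    fun f => funext (SpinWeighted.kernelConv_eq_fourierPart hsl (MeasureTheory.Lp.memLp _))
  refine ⟨fun g hg => SpinWeighted.exists_spinL2_ae_eq hsl hg,
    fun y _ => SpinWeighted.kernel_mem_harmonicSpace s l y, fun f hf x _ => ?_, fun f => ⟨?_, ?_⟩⟩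
  · have hf2 := SpinWeighted.memLp_of_mem_harmonicSpace hsl hf
    exact ⟨SpinWeighted.integrable_kernel_mul hsl hf2 x,
      by rw [SpinWeighted.kernelConv_eq_fourierPart hsl hf2, SpinWeighted.fourierPart_eq_self hsl hf]⟩
  · exact fun x _ => ⟨SpinWeighted.integrable_kernel_mul hsl (MeasureTheory.Lp.memLp _) x,
      congrFun (hconv f) x⟩
  · rw [hconv]
    exact SpinWeighted.fourierPart_ae_eq_starProjection hsl f
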